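/- Let $G$ be a countable discrete abelian group. An operation is a tuple $e=(\gamma_e,s_{e,0},\dots,s_{e,\gamma_e-1},g_{e,0},\dots,g_{e,\gamma_e-1})$ with an integer $\gamma_e>1$, $s_{e,i}\in\mathbb N_0$ and $g_{e,i}\in G$. Let $F$ be a sequence of operations, $F(n)=(\gamma_n,s(n,0),\dots,s(n,\gamma_n-1),g(n,0),\dots,g(n,\gamma_n-1))$, $n\in\mathbb N_0$, such that for all $n,d\in\mathbb N_0$ there are infinitely many $m$ with $F(n+i)=F(m+i)$ for all $0\le i<d$. Construct columns (finite sequences of disjoint intervals of equal length, called levels) $C_{N,g}$ for $N\in\mathbb N_0$, $g\in G$ as follows. The columns $C_{0,g}$, $g\in G$, consist each of one interval of length $1$, and these intervals are disjoint. Given the columns $C_{N,g}$, cut every level of every $C_{N,g}$ into $\gamma_N$ subintervals of equal length, numbered $0,\dots,\gamma_N-1$ from left to right, and let $C_{N,g,i}$ be the sequence of the $i$-th subintervals of the levels of $C_{N,g}$, in the same order. Then $C_{N+1,g}$ consists, from bottom to top, of $C_{N,g+g(N,0),0}$, then $s(N,0)$ spacers, then $C_{N,g+g(N,1),1}$, then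 $s(N,1)$ spacers, and so on up to $C_{N,g+g(N,\gamma_N-1),\gamma_N-1}$ and then $s(N,\gamma_N-1)$ spacers, where the spacers are new intervals, disjoint from each other and from everything used before, of the same length as the subintervals. Let $X$ be the union of all levels of all columns, with Lebesgue measure $\mu$, and let $T$ be the transformation, defined $\mu$-almost everywhere on $X$, that maps each level of a column other than the top one by translation onto the level just above it. Then $T$ is multiply recurrent: for every measurable set $A\subseteq X$ with $\mu(A)>0$ and every integer $d>0$ there is an integer $n>0$ with $$\mu\bigl(A\cap T^nA\cap T^{2n}A\cap\dots\cap T^{dn}A\bigr)>0 .$$ This includes the case where $G$ is infinite, in which $\mu(X)=\infty$. -/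

import Mathlib

open MeasureTheory

namespace CutStack

/-- An operation that leads from one generation of columns to the next: cut every level into
`γ > 1` pieces, put `s k` spacers above the `k`-th piece, and let `g k` describe the change of the
`G`-component. -/
structure Operation (G : Type*) where
  γ : ℕ
  one_lt : 1 < γ
  s : Fin γ → ℕ
  g : Fin γ → G

/-- Every finite block of consecutive values of `F` occurs in `F` at infinitely many places. -/
def Admissible {G : Type*} (F : ℕ → Operation G) : Prop :=
  ∀ n d : ℕ, {m : ℕ | ∀ i < d, F (n + i) = F (m + i)}.Infinite

section Construction

variable {G : Type*} [AddCommGroup G] (F : ℕ → Operation G)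

/-- The length of the levels of generation `N`. -/
noncomputable def width (N : ℕ) : ℝ := ∏ n ∈ Finset.range N, ((F n).γ : ℝ)⁻¹

/-- The total length of one column of generation `N`. -/
noncomputable def mass : ℕ → ℝ
  | 0 => 1
  | N + 1 => mass N + ((∑ k, (F N).s k : ℕ) : ℝ) * width F (N + 1)

/-- The intervals live on `G × ℝ`, a disjoint union of copies of the line, one for each `g : G`.
The pair `I = (g, a)` encodes the generation-`N` interval `{g} × [a, a + width F N)`. -/
def level (N : ℕ) (I : G × ℝ) : Set (G × ℝ) :=
  {I.1} ×ˢ Set.Ico I.2 (I.2 + width F N)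

/-- The `k`-th of the `γ` pieces, from left to right, into which the generation-`N` interval `I`
is cut. -/
noncomputable def piece (N : ℕ) (k : Fin (F N).γ) (I : G × ℝ) : G × ℝ :=
  (I.1, I.2 + (k : ℕ) * width F (N + 1))

/-- The `j`-th spacer above the `k`-th subcolumn of the generation-`(N + 1)` column with index `g`.
The levels of generation `N` fill `G × [0, mass F N)`; the spacers of the column with
index `g` are placed next to each other on the line with label `g`, starting at `mass F N`. -/
noncomputable def spacer (N : ℕ) (g : G) (k : Fin (F N).γ) (j : ℕ) : G × ℝ :=
  (g, mass F N + (((∑ l ∈ Finset.univ.filter (· < k), (F N).s l) + j : ℕ) : ℝ) * width F (N + 1))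

/-- The column of generation `N` with index `g`, as the list of its levels from bottom to top. -/
noncomputable def column : ℕ → G → List (G × ℝ)
  | 0, g => [(g, 0)]
  | N + 1, g => (List.finRange (F N).γ).flatMap fun k =>
      (column N (g + (F N).g k)).map (piece F N k) ++
        (List.range ((F N).s k)).map (spacer F N g k)

/-- The space on which the transformation lives: the union of all levels of all columns. -/
def space : Set (G × ℝ) :=
  ⋃ (N : ℕ) (g : G), ⋃ I ∈ column F N g, level F N I

/-- Lebesgue measure on the union of all levels. -/
noncomputable def measure [MeasurableSpace G] : Measure (G × ℝ) :=
  ((Measure.count : Measure G).prod volume).restrict (space F)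

/-- `Step F x y`: in some column, `x` lies in a level `I` that is not the top level, and the
translation of `I` onto the level `J` just above it sends `x` to `y`. -/
def Step (x y : G × ℝ) : Prop :=
  ∃ (N : ℕ) (g : G) (I J : G × ℝ), [I, J] <:+: column F N g ∧
    x ∈ level F N I ∧ y = (J.1, x.2 + (J.2 - I.2))

open Classical in
/-- The transformation: the limit of the translations of levels. The points of the space where it
is not determined by any column form a null set; they are left fixed. -/
noncomputable def transformation (x : G × ℝ) : G × ℝ :=
  if h : ∃ y, Step F x y then h.choose else x

end Construction

/-- `T` is `d`-recurrent. -/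
def IsRecurrent {X : Type*} [MeasurableSpace X] (μ : Measure X) (T : X → X) (d : ℕ) : Prop :=
  ∀ A : Set X, MeasurableSet A → 0 < μ A →
    ∃ n : ℕ, 0 < n ∧ 0 < μ (⋂ j ∈ Finset.range (d + 1), T^[j * n] '' A)

def MultiplyRecurrent {X : Type*} [MeasurableSpace X] (μ : Measure X) (T : X → X) : Prop :=
  ∀ d : ℕ, 0 < d → IsRecurrent μ T d

/-! The translations of levels are consistent, so that the transformation is well defined. -/

section WellDefined

set_option linter.unusedSectionVars false

variable {G : Type*} [AddCommGroup G] (F : ℕ → Operation G)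

theorem width_pos (N : ℕ) : 0 < width F N :=
  Finset.prod_pos fun n _ => inv_pos.2 (by have := (F n).one_lt; positivity)

theorem width_succ (N : ℕ) : ((F N).γ : ℝ) * width F (N + 1) = width F N := by
  have : ((F N).γ : ℝ) ≠ 0 := by have := (F N).one_lt; positivity
  rw [width, width, Finset.prod_range_succ]
  field_simp

theorem piece_subset (N : ℕ) (k : Fin (F N).γ) (I : G × ℝ) :
    level F (N + 1) (piece F N k I) ⊆ level F N I := by
  rintro ⟨a, t⟩ ⟨h1, h2, h3⟩
  have hw := width_pos F (N + 1)
  have hk : ((k : ℕ) : ℝ) + 1 ≤ (F N).γ := by exact_mod_cast k.2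
  have := width_succ F N
  simp only [piece] at h1 h2 h3
  refine ⟨h1, ?_, ?_⟩
  · have : 0 ≤ ((k : ℕ) : ℝ) * width F (N + 1) := by positivity
    simp only; linarith
  · simp only; nlinarith

theorem exists_piece (N : ℕ) (I x : G × ℝ) (hx : x ∈ level F N I) :
    ∃ k, x ∈ level F (N + 1) (piece F N k I) := by
  obtain ⟨h1, h2, h3⟩ := hx
  have hw := width_pos F (N + 1)
  have hs := width_succ F N
  have h0 : 0 ≤ (x.2 - I.2) / width F (N + 1) := div_nonneg (by linarith) hw.le
  have hlt : (x.2 - I.2) / width F (N + 1) < (F N).γ := by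
    rw [div_lt_iff₀ hw]; linarith
  have ha := Nat.floor_le h0
  have hb := Nat.lt_floor_add_one ((x.2 - I.2) / width F (N + 1))
  rw [le_div_iff₀ hw] at ha
  rw [div_lt_iff₀ hw] at hb
  refine ⟨⟨⌊(x.2 - I.2) / width F (N + 1)⌋₊, (Nat.floor_lt h0).2 hlt⟩, h1, ?_, ?_⟩ <;>
    simp only [piece] <;> linarith

theorem piece_disjoint (N : ℕ) (k l : Fin (F N).γ) (I x : G × ℝ)
    (hk : x ∈ level F (N + 1) (piece F N k I)) (hl : x ∈ level F (N + 1) (piece F N l I)) :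
    k = l := by
  obtain ⟨-, h2, h3⟩ := hk
  obtain ⟨-, h4, h5⟩ := hl
  have hw := width_pos F (N + 1)
  simp only [piece] at h2 h3 h4 h5
  have a : ((k : ℕ) : ℝ) < (l : ℕ) + 1 := by by_contra! h; nlinarith
  have b : ((l : ℕ) : ℝ) < (k : ℕ) + 1 := by by_contra! h; nlinarith
  have a' : (k : ℕ) < l + 1 := by exact_mod_cast a
  have b' : (l : ℕ) < k + 1 := by exact_mod_cast b
  ext; omega

theorem spacer_disjoint (N : ℕ) (g g' : G) (k l : Fin (F N).γ) (i j : ℕ) (x : G × ℝ)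
    (hi : i < (F N).s k) (hj : j < (F N).s l)
    (hk : x ∈ level F (N + 1) (spacer F N g k i)) (hl : x ∈ level F (N + 1) (spacer F N g' l j)) :
    g = g' ∧ k = l ∧ i = j := by
  obtain ⟨h1, h2, h3⟩ := hk
  obtain ⟨h1', h4, h5⟩ := hl
  have hw := width_pos F (N + 1)
  simp only [spacer] at h1 h1' h2 h3 h4 h5
  have hg : g = g' := by rw [← h1.symm.trans h1']
  set p := ∑ l ∈ Finset.univ.filter (· < k), (F N).s l with hp
  set q := ∑ m ∈ Finset.univ.filter (· < l), (F N).s m with hq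
  have a : ((p + i : ℕ) : ℝ) < (q + j : ℕ) + 1 := by by_contra! h; nlinarith
  have b : ((q + j : ℕ) : ℝ) < (p + i : ℕ) + 1 := by by_contra! h; nlinarith
  have a' : p + i < q + j + 1 := by exact_mod_cast a
  have b' : q + j < p + i + 1 := by exact_mod_cast b
  have key : ∀ u v : Fin (F N).γ, u < v →
      (∑ l ∈ Finset.univ.filter (· < u), (F N).s l) + (F N).s u
        ≤ ∑ l ∈ Finset.univ.filter (· < v), (F N).s l := by
    intro u v huv
    rw [add_comm, ← Finset.sum_insert (by simp)]
    apply Finset.sum_le_sum_of_subset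
    intro z hz
    simp only [Finset.mem_insert, Finset.mem_filter, Finset.mem_univ, true_and] at hz ⊢
    rcases hz with rfl | hz
    · exact huv
    · exact hz.trans huv
  rcases lt_trichotomy k l with h | h | h
  · have := key _ _ h; omega
  · subst h; exact ⟨hg, rfl, by omega⟩
  · have := key _ _ h; omega

theorem mem_column_succ {N : ℕ} {g : G} {K : G × ℝ} :
    K ∈ column F (N + 1) g ↔ ∃ k, (∃ I ∈ column F N (g + (F N).g k), piece F N k I = K) ∨
      ∃ j < (F N).s k, spacer F N g k j = K := by
  simp [column]

theorem level_lt_mass : ∀ (N : ℕ) (g : G), ∀ I ∈ column F N g, ∀ x ∈ level F N I, x.2 < mass F N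
  | 0, g, I, hI, x, hx => by
      simp only [column, List.mem_singleton] at hI
      subst hI
      simpa [level, width, mass] using hx.2.2
  | N + 1, g, K, hK, x, hx => by
      have hw := width_pos F (N + 1)
      obtain ⟨k, ⟨I, hI, rfl⟩ | ⟨j, hj, rfl⟩⟩ := (mem_column_succ F).1 hK
      · have h := level_lt_mass N _ I hI x (piece_subset F N k I hx)
        have : 0 ≤ ((∑ k, (F N).s k : ℕ) : ℝ) * width F (N + 1) := by positivity
        simp only [mass]; linarith
      · have h := hx.2.2
        have hle : (∑ l ∈ Finset.univ.filter (· < k), (F N).s l) + j + 1 ≤ ∑ k, (F N).s k := by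
          calc _ ≤ (∑ l ∈ Finset.univ.filter (· < k), (F N).s l) + (F N).s k := by omega
            _ = ∑ l ∈ insert k (Finset.univ.filter (· < k)), (F N).s l := by
                rw [Finset.sum_insert (by simp), add_comm]
            _ ≤ _ := Finset.sum_le_sum_of_subset (Finset.subset_univ _)
        have hle' : (((∑ l ∈ Finset.univ.filter (· < k), (F N).s l) + j : ℕ) : ℝ) + 1
            ≤ ((∑ k, (F N).s k : ℕ) : ℝ) := by exact_mod_cast hle
        simp only [spacer] at h
        simp only [mass]; nlinarith

theorem piece_spacer_disjoint {N : ℕ} {g g' : G} {k l : Fin (F N).γ} {j : ℕ} {I x : G × ℝ}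
    (hI : I ∈ column F N g) (hx : x ∈ level F (N + 1) (piece F N k I))
    (hx' : x ∈ level F (N + 1) (spacer F N g' l j)) : False := by
  have h1 := level_lt_mass F N g I hI x (piece_subset F N k I hx)
  have h2 := hx'.2.1
  have hw := width_pos F (N + 1)
  simp only [spacer] at h2
  have : 0 ≤ (((∑ m ∈ Finset.univ.filter (· < l), (F N).s m) + j : ℕ) : ℝ) * width F (N + 1) := by
    positivity
  linarith

/-- Distinct levels of the same generation are disjoint. -/
theorem level_unique : ∀ (N : ℕ) (g g' : G), ∀ I ∈ column F N g, ∀ I' ∈ column F N g',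
    ∀ x, x ∈ level F N I → x ∈ level F N I' → g = g' ∧ I = I'
  | 0, g, g', I, hI, I', hI', x, hx, hx' => by
      simp only [column, List.mem_singleton] at hI hI'
      subst hI hI'
      have h : g = g' := hx.1.symm.trans hx'.1
      exact ⟨h, by rw [h]⟩
  | N + 1, g, g', K, hK, K', hK', x, hx, hx' => by
      obtain ⟨k, ⟨I, hI, rfl⟩ | ⟨j, hj, rfl⟩⟩ := (mem_column_succ F).1 hK <;>
        obtain ⟨k', ⟨I', hI', rfl⟩ | ⟨j', hj', rfl⟩⟩ := (mem_column_succ F).1 hK'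
      · obtain ⟨h1, rfl⟩ := level_unique N _ _ I hI I' hI' x (piece_subset F N k I hx)
          (piece_subset F N k' I' hx')
        obtain rfl := piece_disjoint F N k k' I x hx hx'
        exact ⟨add_right_cancel h1, rfl⟩
      · exact (piece_spacer_disjoint F hI hx hx').elim
      · exact (piece_spacer_disjoint F hI' hx' hx).elim
      · obtain ⟨rfl, rfl, rfl⟩ := spacer_disjoint F N g g' k k' j j' x hj hj' hx hx'
        exact ⟨rfl, rfl⟩

theorem level_nonempty (N : ℕ) (I : G × ℝ) : I ∈ level F N I :=
  ⟨rfl, le_rfl, by have := width_pos F N; simpa using this⟩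

theorem piece_inj {N : ℕ} {k : Fin (F N).γ} {I J : G × ℝ} (h : piece F N k I = piece F N k J) :
    I = J := by
  simp only [piece, Prod.mk.injEq] at h
  exact Prod.ext h.1 (by linarith [h.2])

theorem column_nodup : ∀ (N : ℕ) (g : G), (column F N g).Nodup
  | 0, g => by simp [column]
  | N + 1, g => by
      rw [column, List.nodup_flatMap]
      constructor
      · intro k _
        refine List.nodup_append.2 ⟨(column_nodup N _).map fun I J h => piece_inj F h, ?_, ?_⟩
        · refine List.Nodup.map_on ?_ List.nodup_range
          intro i hi j hj h
          exact (spacer_disjoint F N g g k k i j _ (List.mem_range.1 hi) (List.mem_range.1 hj)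
            (level_nonempty F _ _) (h ▸ level_nonempty F _ _)).2.2
        · intro K hK K' hK' h
          obtain ⟨I, hI, rfl⟩ := List.mem_map.1 hK
          obtain ⟨j, hj, rfl⟩ := List.mem_map.1 hK'
          exact piece_spacer_disjoint F hI (level_nonempty F _ _)
            (by rw [← h]; exact level_nonempty F _ _)
      · refine (List.nodup_finRange _).imp ?_
        intro k l hkl K hK hK'
        rcases List.mem_append.1 hK with hK | hK <;> rcases List.mem_append.1 hK' with hK' | hK'
        · obtain ⟨I, hI, rfl⟩ := List.mem_map.1 hK
          obtain ⟨J, hJ, h⟩ := List.mem_map.1 hK'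
          have hx := level_nonempty F (N + 1) (piece F N k I)
          have hx' : piece F N k I ∈ level F (N + 1) (piece F N l J) := h ▸ hx
          obtain ⟨-, rfl⟩ := level_unique F N _ _ I hI J hJ _ (piece_subset F N k I hx)
            (piece_subset F N l J hx')
          exact hkl (piece_disjoint F N k l I _ hx hx')
        · obtain ⟨I, hI, rfl⟩ := List.mem_map.1 hK
          obtain ⟨j, hj, h⟩ := List.mem_map.1 hK'
          exact piece_spacer_disjoint F hI (level_nonempty F _ _)
            (by rw [h]; exact level_nonempty F _ _)
        · obtain ⟨I, hI, rfl⟩ := List.mem_map.1 hK'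
          obtain ⟨j, hj, h⟩ := List.mem_map.1 hK
          exact piece_spacer_disjoint F hI (level_nonempty F _ _)
            (by rw [h]; exact level_nonempty F _ _)
        · obtain ⟨i, hi, rfl⟩ := List.mem_map.1 hK
          obtain ⟨j, hj, h⟩ := List.mem_map.1 hK'
          exact hkl (spacer_disjoint F N g g k l i j _ (List.mem_range.1 hi) (List.mem_range.1 hj)
            (level_nonempty F _ _) (h ▸ level_nonempty F _ _)).2.1

/-- The translations of one generation extend those of the previous one. -/
theorem step_succ {N : ℕ} {g : G} {I J x : G × ℝ} (h : [I, J] <:+: column F N g)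
    (hx : x ∈ level F N I) : ∃ (g' : G) (I' J' : G × ℝ), [I', J'] <:+: column F (N + 1) g' ∧
      x ∈ level F (N + 1) I' ∧ J'.1 = J.1 ∧ J'.2 - I'.2 = J.2 - I.2 := by
  obtain ⟨k, hk⟩ := exists_piece F N I x hx
  refine ⟨g - (F N).g k, piece F N k I, piece F N k J, ?_, hk, rfl, by simp [piece]⟩
  obtain ⟨a, b, hab⟩ := List.append_of_mem (List.mem_finRange k)
  rw [column, hab, List.flatMap_append, List.flatMap_cons, sub_add_cancel]
  refine List.IsInfix.trans (h.map (piece F N k)) ?_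
  exact ⟨_, _, by simp only [List.append_assoc]; rfl⟩

theorem step_add {N : ℕ} {g : G} {I J x : G × ℝ} (h : [I, J] <:+: column F N g)
    (hx : x ∈ level F N I) (m : ℕ) : ∃ (g' : G) (I' J' : G × ℝ),
      [I', J'] <:+: column F (N + m) g' ∧
      x ∈ level F (N + m) I' ∧ J'.1 = J.1 ∧ J'.2 - I'.2 = J.2 - I.2 := by
  induction m with
  | zero => exact ⟨g, I, J, h, hx, rfl, rfl⟩
  | succ m ih =>
      obtain ⟨g', I', J', h1, h2, h3, h4⟩ := ih
      obtain ⟨g'', I'', J'', k1, k2, k3, k4⟩ := step_succ F h1 h2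
      exact ⟨g'', I'', J'', k1, k2, k3.trans h3, k4.trans h4⟩

theorem infix_unique {α : Type*} {L : List α} (hL : L.Nodup) {a b c : α}
    (h : [a, b] <:+: L) (h' : [a, c] <:+: L) : b = c := by
  obtain ⟨s, t, rfl⟩ := h
  obtain ⟨s', t', h⟩ := h'
  have e : s' ++ a :: (c :: t') = s ++ a :: (b :: t) := by simpa using h
  have hn : (s ++ a :: (b :: t)).Nodup := by simpa using hL
  have hn' : (s' ++ a :: (c :: t')).Nodup := e ▸ hn
  have h1 : a ∉ s := fun ha => (List.nodup_append.1 hn).2.2 a ha a (by simp) rfl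
  have h2 : a ∉ s' := fun ha => (List.nodup_append.1 hn').2.2 a ha a (by simp) rfl
  rcases List.append_eq_append_iff.1 e with ⟨u, hu, hv⟩ | ⟨u, hu, hv⟩
  · cases u with
    | nil => simp at hv; exact hv.1.symm
    | cons z u => simp at hv; exact (h1 (by rw [hu, hv.1]; simp)).elim
  · cases u with
    | nil => simp at hv; exact hv.1
    | cons z u => simp at hv; exact (h2 (by rw [hu, hv.1]; simp)).elim

theorem step_unique {x y z : G × ℝ} (hy : Step F x y) (hz : Step F x z) : y = z := by
  obtain ⟨N, g, I, J, h1, h2, rfl⟩ := hy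
  obtain ⟨M, g', I', J', h1', h2', rfl⟩ := hz
  obtain ⟨a, K, L, k1, k2, k3, k4⟩ := step_add F h1 h2 M
  obtain ⟨b, K', L', l1, l2, l3, l4⟩ := step_add F h1' h2' N
  rw [add_comm M N] at l1 l2
  obtain ⟨rfl, rfl⟩ := level_unique F _ _ _ K (k1.subset (by simp)) K' (l1.subset (by simp))
    x k2 l2
  obtain rfl := infix_unique (column_nodup F _ _) k1 l1
  rw [← k3, ← l3, ← k4, ← l4]

/-- On a level that is not the top one of its column, the transformation is the translation onto
the level above. -/
theorem transformation_eq {x y : G × ℝ} (h : Step F x y) : transformation F x = y := by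
  have h' : ∃ y, Step F x y := ⟨y, h⟩
  rw [transformation, dif_pos h']
  exact step_unique F h'.choose_spec h

end WellDefined

end CutStack

/-! Cutting a level of generation `p` down to generation `p + M` gives one sublevel per string of
digits, a digit saying which piece is kept at each cut. The string determines the column and the
place of the sublevel. The core is `Admissible.exists_progression`: there is an `M`, depending only
on `F` and `d`, such that wherever the first `M` operations recur, at `p` say, `d + 1` sublevels of
each generation-`p` level lie in one column at places in arithmetic progression. If `n` is its
difference, `T^n` carries each of them onto the next. Each is a proportion `width F M` of the level,
whatever `p` is, so by Lebesgue density `p` and the level can be chosen such that the part of it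
outside `A` is too small for `d + 1` translates of it to cover a sublevel.

For the progression, put `Γ = γ_0 ⋯ γ_{d-1}` and take `2Γ` disjoint repetitions (windows) of the
first `d + 1` operations. Read the digits in window `i` as a mixed radix integer `v_i`. Up to
constants, the place is `∑ (v_i h_i + B(v_i))`, with `h_i` the height at the start of the window,
and the change of column is `∑ C(v_i)`; `B` and `C` are the same functions for all windows. As `j`
grows by one, each `v_i` drops by one in the first `Γ` windows and rises by one in the last `Γ`. As
multisets, the values `Γ + (Γ-1-j)` and `j` are replaced by `Γ-1-j` and `Γ + j`: a top digit `1`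
moves from one number to the other. Hence `∑ B` and `∑ C` stay constant for any spacers and shifts,
while the place grows by the sum of the last `Γ` heights minus the sum of the first `Γ`, which is
positive. -/

open MeasureTheory

namespace CutStack

/-! ### Heights of columns and places of levels -/

/-- The number of spacers below the `k`-th subcolumn (`0` if there is no such subcolumn). -/
def Operation.spacersBelow {G : Type*} (e : Operation G) (k : ℕ) : ℕ :=
  if h : k < e.γ then ∑ l ∈ Finset.univ.filter (· < (⟨k, h⟩ : Fin e.γ)), e.s l else 0

/-- The change of the `G`-component on the `k`-th subcolumn (`0` if there is no such subcolumn). -/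
def Operation.shift {G : Type*} [AddCommGroup G] (e : Operation G) (k : ℕ) : G :=
  if h : k < e.γ then e.g ⟨k, h⟩ else 0

theorem Operation.spacersBelow_zero {G : Type*} (e : Operation G) : e.spacersBelow 0 = 0 := by
  have h : 0 < e.γ := zero_lt_one.trans e.one_lt
  rw [Operation.spacersBelow, dif_pos h]
  refine Finset.sum_eq_zero fun l hl => ?_
  simp [Fin.lt_def] at hl

/-- The number of levels of the columns of generation `N`. -/
def height {G : Type*} (F : ℕ → Operation G) : ℕ → ℕ
  | 0 => 1
  | N + 1 => (F N).γ * height F N + ∑ k, (F N).s k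

theorem height_pos {G : Type*} (F : ℕ → Operation G) (N : ℕ) : 0 < height F N := by
  induction N with
  | zero => exact zero_lt_one
  | succ N ih =>
    have := Nat.mul_pos (zero_lt_one.trans (F N).one_lt) ih
    simp only [height]
    omega

theorem height_strictMono {G : Type*} (F : ℕ → Operation G) : StrictMono (height F) := by
  refine strictMono_nat_of_lt_succ fun N => ?_
  have h1 := (Nat.mul_lt_mul_right (height_pos F N)).2 (F N).one_lt
  simp only [height]
  omega

theorem getElem?_flatMap_finRange {α : Type*} {n : ℕ} (f : Fin n → List α) (k : Fin n) {i : ℕ}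
    (hi : i < (f k).length) :
    ((List.finRange n).flatMap f)[(∑ l ∈ Finset.univ.filter (· < k), (f l).length) + i]? =
      (f k)[i]? := by
  induction n with
  | zero => exact k.elim0
  | succ n ih =>
    rw [List.finRange_succ, List.flatMap_cons, List.flatMap_map]
    induction k using Fin.cases with
    | zero =>
      rw [Finset.filter_false_of_mem (by simp), Finset.sum_empty, zero_add,
        List.getElem?_append_left hi]
    | succ k =>
      have hs : ∑ l ∈ Finset.univ.filter (· < k.succ), (f l).length =
          (f 0).length + ∑ l ∈ Finset.univ.filter (· < k), (f l.succ).length := by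
        rw [Finset.sum_filter, Finset.sum_filter, Fin.sum_univ_succ]
        simp
      rw [hs, add_assoc, List.getElem?_append_right (by omega), Nat.add_sub_cancel_left]
      exact ih (fun l => f l.succ) k hi

section

variable {G : Type*} [AddCommGroup G] (F : ℕ → Operation G)

theorem length_column (N : ℕ) (g : G) : (column F N g).length = height F N := by
  induction N generalizing g with
  | zero => simp [column, height]
  | succ N ih =>
    simp only [column, List.length_flatMap, List.length_append, List.length_map, ih,
      List.length_range, height]
    rw [← List.ofFn_eq_map, List.sum_ofFn, Finset.sum_add_distrib]
    simp

theorem getElem?_column_succ {N : ℕ} {g : G} {r : ℕ} {I : G × ℝ} {k : ℕ}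
    (hI : (column F N g)[r]? = some I) (hk : k < (F N).γ) :
    (column F (N + 1) (g - (F N).shift k))[r + (k * height F N + (F N).spacersBelow k)]? =
      some (I.1, I.2 + k * width F (N + 1)) := by
  obtain ⟨hr, -⟩ := List.getElem?_eq_some_iff.1 hI
  rw [length_column] at hr
  rw [Operation.shift, dif_pos hk, Operation.spacersBelow, dif_pos hk, column]
  have h := getElem?_flatMap_finRange (fun l : Fin (F N).γ =>
      (column F N (g - (F N).g ⟨k, hk⟩ + (F N).g l)).map (piece F N l) ++
        (List.range ((F N).s l)).map (spacer F N (g - (F N).g ⟨k, hk⟩) l)) ⟨k, hk⟩ (i := r)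
      (by simp only [List.length_append, List.length_map, length_column]; omega)
  simp only [List.length_append, List.length_map, length_column, List.length_range,
    Finset.sum_add_distrib, Finset.sum_const, Finset.filter_gt_eq_Iio, Fin.card_Iio,
    smul_eq_mul] at h
  rw [add_comm r, Finset.filter_gt_eq_Iio, h, List.getElem?_append_left
    (by simpa [length_column] using hr), sub_add_cancel, List.getElem?_map, hI]
  rfl

/-! ### Sublevels described by digits; iterates of the transformation -/

/-- Every level of a generation-`N` column contains a generation-`N'` level which is shifted by `t`
to the right and lies, in a column whose index is smaller by `z`, at a place higher by `δ`. -/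
def Descends (N N' δ : ℕ) (z : G) (t : ℝ) : Prop :=
  0 ≤ t ∧ t + width F N' ≤ width F N ∧
    ∀ (g : G) (r : ℕ) (I : G × ℝ), (column F N g)[r]? = some I →
      (column F N' (g - z))[r + δ]? = some (I.1, I.2 + t)

variable {F}

theorem Descends.refl (N : ℕ) : Descends F N N 0 0 0 :=
  ⟨le_rfl, by simp, fun g r I h => by simpa using h⟩

theorem Descends.trans {N N' N'' δ δ' : ℕ} {z z' : G} {t t' : ℝ} (h : Descends F N N' δ z t)
    (h' : Descends F N' N'' δ' z' t') : Descends F N N'' (δ + δ') (z + z') (t + t') := by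
  refine ⟨add_nonneg h.1 h'.1, by linarith [h.2.1, h'.2.1], fun g r I hI => ?_⟩
  have := h'.2.2 _ _ _ (h.2.2 g r I hI)
  rwa [sub_sub, add_assoc, add_assoc] at this

/-- Below the `k`-th subcolumn lie `k` full subcolumns and the spacers between them. The index drops
because column `g` of the next generation uses column `g + shift k`. -/
theorem Descends.of_digit {N k : ℕ} (hk : k < (F N).γ) :
    Descends F N (N + 1) (k * height F N + (F N).spacersBelow k) ((F N).shift k)
      (k * width F (N + 1)) := by
  have hw := width_pos F (N + 1)
  have hk' : (k : ℝ) + 1 ≤ (F N).γ := by exact_mod_cast hk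
  refine ⟨by positivity, ?_, fun g r I hI => getElem?_column_succ F hI hk⟩
  rw [← width_succ F N]
  nlinarith

theorem Descends.of_digits (N : ℕ) (w : ℕ → ℕ) (M : ℕ) (hw : ∀ i < M, w i < (F (N + i)).γ) :
    ∃ t, Descends F N (N + M)
      (∑ i ∈ Finset.range M, (w i * height F (N + i) + (F (N + i)).spacersBelow (w i)))
      (∑ i ∈ Finset.range M, (F (N + i)).shift (w i)) t := by
  induction M with
  | zero => exact ⟨0, by simpa using Descends.refl N⟩
  | succ M ih =>
    obtain ⟨t, ht⟩ := ih fun i hi => hw i (by omega)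
    refine ⟨t + w M * width F (N + M + 1), ?_⟩
    rw [Finset.sum_range_succ, Finset.sum_range_succ]
    exact ht.trans (Descends.of_digit (hw M (by omega)))

theorem Descends.of_zeros {N N' : ℕ} (h : N ≤ N') : ∃ (z : G) (t : ℝ), Descends F N N' 0 z t := by
  obtain ⟨M, rfl⟩ := Nat.exists_eq_add_of_le h
  obtain ⟨t, ht⟩ := Descends.of_digits (F := F) N (fun _ => 0) M
    fun i _ => zero_lt_one.trans (F (N + i)).one_lt
  refine ⟨∑ i ∈ Finset.range M, (F (N + i)).shift 0, t, ?_⟩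
  simpa [Operation.spacersBelow_zero] using ht

/-- All places from `r` to `r + n` are occupied in one column, so no top level intervenes and the
translations telescope. -/
theorem iterate_transformation {N : ℕ} {g : G} {I J x : G × ℝ} {r n : ℕ}
    (hI : (column F N g)[r]? = some I) (hJ : (column F N g)[r + n]? = some J)
    (hx : x ∈ level F N I) : (transformation F)^[n] x = (J.1, x.2 + (J.2 - I.2)) := by
  induction n generalizing J with
  | zero =>
    obtain rfl : I = J := Option.some.inj (hI.symm.trans hJ)
    have hx1 : x.1 = I.1 := hx.1
    simp [← hx1]
  | succ n ih =>
    obtain ⟨hlt, hJ'⟩ := List.getElem?_eq_some_iff.1 hJ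
    have hlt' : r + n < (column F N g).length := by omega
    have hK := List.getElem?_eq_getElem hlt'
    set K := (column F N g)[r + n] with hKdef
    rw [Function.iterate_succ_apply', ih hK]
    refine transformation_eq F ⟨N, g, K, J, ?_, ?_, ?_⟩
    · refine ⟨(column F N g).take (r + n), (column F N g).drop (r + n + 2), ?_⟩
      have h1 : (column F N g).drop (r + n) = K :: J :: (column F N g).drop (r + n + 2) := by
        rw [List.drop_eq_getElem_cons hlt', List.drop_eq_getElem_cons (by omega)]
        simp [← hJ', hKdef, add_assoc]
      simp [← h1]
    · obtain ⟨-, h2, h3⟩ := hx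
      refine ⟨rfl, ?_, ?_⟩ <;> simp only <;> linarith
    · simp only [Prod.mk.injEq, true_and]
      ring

end

/-! ### Windows sliding in opposite directions -/

/-- If `f` behaves like a function of the residue modulo `Γ` plus a function of the quotient, then
two windows of length `Γ` that move in opposite directions have a constant sum. -/
theorem sum_opposite_windows {M : Type*} [AddCancelCommMonoid M] (f : ℕ → M) (Γ : ℕ)
    (hf : ∀ x < Γ, ∀ y < Γ, f (Γ + x) + f y = f x + f (Γ + y)) (j : ℕ) (hj : j ≤ Γ) :
    ∑ u ∈ Finset.range Γ, f (Γ + u - j) + ∑ u ∈ Finset.range Γ, f (u + j) =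
      ∑ u ∈ Finset.range Γ, f (Γ + u) + ∑ u ∈ Finset.range Γ, f u := by
  induction j with
  | zero => simp
  | succ j ih =>
    rw [← ih (by omega)]
    have hup : ∑ u ∈ Finset.range Γ, f (u + (j + 1)) + f j =
        ∑ u ∈ Finset.range Γ, f (u + j) + f (Γ + j) := by
      rw [← Finset.sum_range_succ (fun u => f (u + j)), Finset.sum_range_succ', zero_add]
      simp only [add_assoc, add_comm 1 j]
    have hdown : ∑ u ∈ Finset.range Γ, f (Γ + u - (j + 1)) + f (Γ + (Γ - 1 - j)) =
        ∑ u ∈ Finset.range Γ, f (Γ + u - j) + f (Γ - 1 - j) := by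
      have e1 : f (Γ + (Γ - 1 - j)) = f (Γ + Γ - (j + 1)) := by congr 1; omega
      have e2 : f (Γ - 1 - j) = f (Γ + 0 - (j + 1)) := by congr 1; omega
      have e3 : ∑ u ∈ Finset.range Γ, f (Γ + u - j) =
          ∑ u ∈ Finset.range Γ, f (Γ + (u + 1) - (j + 1)) :=
        Finset.sum_congr rfl fun u _ => by congr 1; omega
      rw [e1, e2, e3, ← Finset.sum_range_succ (fun u => f (Γ + u - (j + 1))),
        ← Finset.sum_range_succ' (fun u => f (Γ + u - (j + 1)))]
    -- The two terms lost and the two gained balance. They are added to both sides because `M` has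
    -- no subtraction.
    have hx := hf j (by omega) (Γ - 1 - j) (by omega)
    refine add_right_cancel (b := f j + f (Γ + (Γ - 1 - j))) ?_
    calc _ = (∑ u ∈ Finset.range Γ, f (Γ + u - (j + 1)) + f (Γ + (Γ - 1 - j))) +
          (∑ u ∈ Finset.range Γ, f (u + (j + 1)) + f j) := by abel
      _ = ∑ u ∈ Finset.range Γ, f (Γ + u - j) + ∑ u ∈ Finset.range Γ, f (u + j) +
          (f (Γ + j) + f (Γ - 1 - j)) := by rw [hup, hdown]; abel
      _ = _ := by rw [hx]

theorem sum_range_add_ite {M : Type*} [AddCommMonoid M] (Γ j : ℕ) (φ : ℕ → ℕ → M) :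
    ∑ i ∈ Finset.range (Γ + Γ), φ i (if i < Γ then Γ + i - j else i - Γ + j) =
      ∑ u ∈ Finset.range Γ, φ u (Γ + u - j) + ∑ u ∈ Finset.range Γ, φ (Γ + u) (u + j) := by
  rw [Finset.sum_range_add]
  congr 1
  · exact Finset.sum_congr rfl fun u hu => by rw [if_pos (Finset.mem_range.1 hu)]
  · exact Finset.sum_congr rfl fun u _ => by rw [if_neg (by omega), Nat.add_sub_cancel_left]

/-! ### Mixed radix digits and repeated blocks -/

section Digits

variable {G : Type*} (F : ℕ → Operation G)

/-- The number of pieces into which a level of generation `0` is cut up to generation `L`. -/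
def cuts (L : ℕ) : ℕ := ∏ i ∈ Finset.range L, (F i).γ

/-- The digits of `v` in the mixed radix system given by the numbers of pieces. -/
def digit (v l : ℕ) : ℕ := v / cuts F l % (F l).γ

theorem cuts_succ (L : ℕ) : cuts F (L + 1) = cuts F L * (F L).γ := Finset.prod_range_succ _ _

theorem cuts_pos (L : ℕ) : 0 < cuts F L :=
  Finset.prod_pos fun i _ => zero_lt_one.trans (F i).one_lt

theorem lt_cuts (L : ℕ) : L < cuts F L := by
  induction L with
  | zero => exact cuts_pos F 0
  | succ L ih =>
    have := Nat.mul_le_mul_left (cuts F L) (F L).one_lt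
    rw [cuts_succ]
    omega

theorem cuts_dvd {l L : ℕ} (h : l ≤ L) : cuts F l ∣ cuts F L :=
  Finset.prod_dvd_prod_of_subset _ _ _ (Finset.range_mono h)

theorem digit_lt (v l : ℕ) : digit F v l < (F l).γ :=
  Nat.mod_lt _ (zero_lt_one.trans (F l).one_lt)

theorem sum_digit (v L : ℕ) : ∑ l ∈ Finset.range L, digit F v l * cuts F l = v % cuts F L := by
  induction L with
  | zero => simp [cuts, Nat.mod_one]
  | succ L ih => rw [Finset.sum_range_succ, ih, cuts_succ, Nat.mod_mul, digit, mul_comm]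

theorem digit_cuts_add {D l : ℕ} (h : l < D) (x : ℕ) : digit F (cuts F D + x) l = digit F x l := by
  obtain ⟨c, hc⟩ := cuts_dvd F (Nat.succ_le_of_lt h)
  rw [digit, digit, hc, Nat.succ_eq_add_one, cuts_succ, mul_assoc,
    Nat.mul_add_div (cuts_pos F l), Nat.mul_add_mod]

theorem digit_of_lt_cuts {D x : ℕ} (hx : x < cuts F D) : digit F x D = 0 := by
  rw [digit, Nat.div_eq_of_lt hx, Nat.zero_mod]

theorem digit_cuts_add_self {D x : ℕ} (hx : x < cuts F D) : digit F (cuts F D + x) D = 1 := by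
  rw [digit, Nat.add_div_left _ (cuts_pos F D), Nat.div_eq_of_lt hx, Nat.mod_eq_of_lt (F D).one_lt]

/-- Adding `cuts F D` to a number below it changes only digit `D`, from `0` to `1`, so the effect
does not depend on the number. This is the hypothesis of `sum_opposite_windows`. -/
theorem sum_digit_exchange {M : Type*} [AddCommMonoid M] (φ : ℕ → ℕ → M) {D x y : ℕ}
    (hx : x < cuts F D) (hy : y < cuts F D) :
    ∑ l ∈ Finset.range (D + 1), φ l (digit F (cuts F D + x) l) +
        ∑ l ∈ Finset.range (D + 1), φ l (digit F y l) =
      ∑ l ∈ Finset.range (D + 1), φ l (digit F x l) +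
        ∑ l ∈ Finset.range (D + 1), φ l (digit F (cuts F D + y) l) := by
  have h : ∀ z, ∑ l ∈ Finset.range D, φ l (digit F (cuts F D + z) l) =
      ∑ l ∈ Finset.range D, φ l (digit F z l) := fun z =>
    Finset.sum_congr rfl fun l hl => by rw [digit_cuts_add F (Finset.mem_range.1 hl)]
  simp only [Finset.sum_range_succ, h, digit_of_lt_cuts F hx, digit_of_lt_cuts F hy,
    digit_cuts_add_self F hx, digit_cuts_add_self F hy]
  abel

/-- The number of levels of a generation-`L` column that are not in generation `0`. -/
def spacersUpTo : ℕ → ℕ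
  | 0 => 0
  | L + 1 => (F L).γ * spacersUpTo L + ∑ k, (F L).s k

/-- Each operation acts on the height by an affine map, so a repeated block acts by the same affine
map wherever it occurs. -/
theorem height_add {q : ℕ} (L : ℕ) (h : ∀ i < L, F i = F (q + i)) :
    height F (q + L) = cuts F L * height F q + spacersUpTo F L := by
  induction L with
  | zero => simp [cuts, spacersUpTo]
  | succ L ih =>
    rw [← add_assoc, height, ih fun i hi => h i (by omega), ← h L (by omega), cuts_succ,
      spacersUpTo]
    ring

/-- The part of the change of place coming from the digits of `v` that does not depend on the
generation at which the block of the first `L` operations is repeated. -/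
def spacerOffset (L v : ℕ) : ℕ :=
  ∑ l ∈ Finset.range L,
    (digit F v l * spacersUpTo F l + (F l).spacersBelow (digit F v l))

/-- The change of the `G`-component coming from the first `L` digits of `v`. -/
def totalShift [AddCommGroup G] (L v : ℕ) : G :=
  ∑ l ∈ Finset.range L, (F l).shift (digit F v l)

theorem Admissible.exists_windows {F : ℕ → Operation G} (hF : Admissible F) (L : ℕ) :
    ∃ m : ℕ → ℕ, m 0 = 0 ∧ (∀ i, ∀ l < L, F l = F (m i + l)) ∧ ∀ i, m i + L ≤ m (i + 1) := by
  have h : ∀ n, ∃ m, (∀ l < L, F l = F (m + l)) ∧ n ≤ m := fun n => by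
    obtain ⟨m, hm, hnm⟩ := (hF 0 L).exists_gt n
    exact ⟨m, fun l hl => by simpa using hm l hl, hnm.le⟩
  choose f hf hle using h
  refine ⟨fun i => Nat.rec 0 (fun _ x => f (x + L)) i, rfl, fun i => ?_, fun i => hle _⟩
  cases i with
  | zero => simp
  | succ i => exact hf _

end Digits

/-! ### Sublevels at places in arithmetic progression -/

section Windows

variable {G : Type*} [AddCommGroup G] {F : ℕ → Operation G}

/-- By `height_add`, the part of each digit's contribution proportional to `height F q` is the digit
times `cuts F l`; these sum to `v`. The rest is independent of `q`. -/
theorem Descends.of_window {q L : ℕ} (h : ∀ i < L, F i = F (q + i)) {v : ℕ} (hv : v < cuts F L) :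
    ∃ t, Descends F q (q + L) (v * height F q + spacerOffset F L v) (totalShift F L v) t := by
  obtain ⟨t, ht⟩ := Descends.of_digits (F := F) q (digit F v) L fun i hi => by
    rw [← h i hi]; exact digit_lt F v i
  refine ⟨t, ?_⟩
  convert ht using 1
  · rw [spacerOffset]
    nth_rewrite 1 [← Nat.mod_eq_of_lt hv, ← sum_digit]
    rw [Finset.sum_mul, ← Finset.sum_add_distrib]
    refine Finset.sum_congr rfl fun l hl => ?_
    have hl' := Finset.mem_range.1 hl
    rw [height_add F l fun i hi => h i (by omega), ← h l hl']
    ring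
  · exact Finset.sum_congr rfl fun l hl => by rw [h l (Finset.mem_range.1 hl)]

/-- The gaps between windows are crossed with digits `0`, which leave the place unchanged; their
shifts go into `z`, which is therefore the same for all `v`. -/
theorem Descends.of_windows {q : ℕ → ℕ} {L : ℕ} (k : ℕ)
    (h : ∀ i < k, ∀ l < L, F l = F (q i + l)) (hq : ∀ i < k, q i + L ≤ q (i + 1)) :
    ∃ z : G, ∀ v : ℕ → ℕ, (∀ i < k, v i < cuts F L) → ∃ t, Descends F (q 0) (q k)
      (∑ i ∈ Finset.range k, (v i * height F (q i) + spacerOffset F L (v i)))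
      (z + ∑ i ∈ Finset.range k, totalShift F L (v i)) t := by
  induction k with
  | zero => exact ⟨0, fun v _ => ⟨0, by simpa using Descends.refl (q 0)⟩⟩
  | succ k ih =>
    obtain ⟨z, hz⟩ := ih (fun i hi => h i (by omega)) (fun i hi => hq i (by omega))
    obtain ⟨z', t', ht'⟩ := Descends.of_zeros (F := F) (hq k (by omega))
    refine ⟨z + z', fun v hv => ?_⟩
    obtain ⟨t, ht⟩ := hz v fun i hi => hv i (by omega)
    obtain ⟨t₁, ht₁⟩ := Descends.of_window (h k (by omega)) (hv k (by omega))
    refine ⟨t + t₁ + t', ?_⟩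
    convert (ht.trans ht₁).trans ht' using 1
    · rw [Finset.sum_range_succ, add_zero]
    · rw [Finset.sum_range_succ]; abel

/-- Wherever a sufficiently long initial block of an admissible sequence is repeated, every level
contains levels of a later generation that lie in the same column, at places which form an
arithmetic progression. -/
theorem Admissible.exists_progression (hF : Admissible F) (d : ℕ) :
    ∃ M, ∀ p, (∀ i < M, F i = F (p + i)) → ∃ n, 0 < n ∧ ∃ (δ : ℕ) (z : G),
      ∀ j ≤ d, ∃ t, Descends F p (p + M) (δ + j * n) z t := by
  obtain ⟨m, hm0, hm, hmle⟩ := hF.exists_windows (d + 1)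
  -- `d < Γ` keeps `Γ + u - j` from truncating; the factor `γ_d ≥ 2` makes room for all numbers
  -- below `2Γ`.
  set Γ := cuts F d with hΓ
  have hdΓ : d < Γ := lt_cuts F d
  have hcuts : Γ + Γ ≤ cuts F (d + 1) := by
    rw [cuts_succ, ← hΓ]
    have := Nat.mul_le_mul_left Γ (F d).one_lt
    omega
  have hmono : StrictMono m := strictMono_nat_of_lt_succ fun i => by have := hmle i; omega
  refine ⟨m (Γ + Γ), fun p hp => ?_⟩
  have hwin : ∀ i < Γ + Γ, ∀ l < d + 1, F l = F (p + m i + l) := fun i hi l hl => by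
    have h1 := hmle i
    have h2 := hmono.monotone (Nat.succ_le_of_lt hi)
    rw [hm i l hl, hp (m i + l) (by simp only [Nat.succ_eq_add_one] at h2; omega), add_assoc]
  obtain ⟨z, hz⟩ := Descends.of_windows (q := fun i => p + m i) (Γ + Γ) hwin
    (fun i _ => by have := hmle i; omega)
  simp only [hm0, add_zero] at hz
  set H : ℕ → ℕ := fun i => height F (p + m i)
  have hHmono : StrictMono H := fun a b hab =>
    height_strictMono F (Nat.add_lt_add_left (hmono hab) p)
  set B := spacerOffset F (d + 1)
  set C : ℕ → G := totalShift F (d + 1)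
  have hB := sum_opposite_windows B Γ fun x hx y hy => sum_digit_exchange F
    (fun l k => k * spacersUpTo F l + (F l).spacersBelow k) hx hy
  have hC := sum_opposite_windows C Γ fun x hx y hy => sum_digit_exchange F
    (fun l k => (F l).shift k) hx hy
  have hlow : ∑ u ∈ Finset.range Γ, H u < ∑ u ∈ Finset.range Γ, H (Γ + u) :=
    Finset.sum_lt_sum_of_nonempty ⟨0, Finset.mem_range.2 (by omega)⟩
      fun u _ => hHmono (by omega)
  obtain ⟨n, hn⟩ := Nat.exists_eq_add_of_lt hlow
  -- The difference is the gap between the two height sums; the base place and the shift are the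
  -- values at `j = 0`.
  refine ⟨n + 1, by omega, ∑ u ∈ Finset.range Γ, (Γ + u) * H u +
    ∑ u ∈ Finset.range Γ, u * H (Γ + u) +
      (∑ u ∈ Finset.range Γ, B (Γ + u) + ∑ u ∈ Finset.range Γ, B u),
    z + (∑ u ∈ Finset.range Γ, C (Γ + u) + ∑ u ∈ Finset.range Γ, C u), fun j hj => ?_⟩
  obtain ⟨t, ht⟩ := hz (fun i => if i < Γ then Γ + i - j else i - Γ + j) fun i hi => by
    split_ifs <;> omega
  refine ⟨t, ?_⟩
  convert ht using 1
  · rw [Finset.sum_add_distrib, sum_range_add_ite Γ j (fun _ v => B v),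
      sum_range_add_ite Γ j (fun i v => v * H i), hB j (by omega), add_right_comm]
    congr 1
    refine Nat.add_right_cancel (m := j * ∑ u ∈ Finset.range Γ, H u) ?_
    have e1 : ∑ u ∈ Finset.range Γ, (Γ + u - j) * H u + j * ∑ u ∈ Finset.range Γ, H u =
        ∑ u ∈ Finset.range Γ, (Γ + u) * H u := by
      rw [Finset.mul_sum, ← Finset.sum_add_distrib]
      refine Finset.sum_congr rfl fun u _ => ?_
      rw [← add_mul, Nat.sub_add_cancel (by omega)]
    have e2 : ∑ u ∈ Finset.range Γ, (u + j) * H (Γ + u) =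
        ∑ u ∈ Finset.range Γ, u * H (Γ + u) + j * ∑ u ∈ Finset.range Γ, H (Γ + u) := by
      rw [Finset.mul_sum, ← Finset.sum_add_distrib]
      exact Finset.sum_congr rfl fun u _ => add_mul _ _ _
    rw [e2, ← e1, hn]
    ring
  · rw [sum_range_add_ite Γ j (fun _ v => C v), hC j (by omega)]

end Windows

/-! ### Widths of levels and Lebesgue density -/

section Width

variable {G : Type*} (F : ℕ → Operation G)

theorem width_add (p M : ℕ) (h : ∀ i < M, F i = F (p + i)) :
    width F (p + M) = width F p * width F M := by
  rw [width, width, width, Finset.prod_range_add]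
  congr 1
  refine Finset.prod_congr rfl fun i hi => ?_
  rw [h i (Finset.mem_range.1 hi)]

theorem width_le_pow [AddCommGroup G] (N : ℕ) : width F N ≤ (1 / 2) ^ N := by
  induction N with
  | zero => simp [width]
  | succ N ih =>
    have h := width_succ F N
    have h2 : (2 : ℝ) ≤ (F N).γ := by exact_mod_cast (F N).one_lt
    have hw := width_pos F (N + 1)
    rw [pow_succ]
    nlinarith

theorem tendsto_width [AddCommGroup G] : Filter.Tendsto (width F) Filter.atTop (nhds 0) :=
  squeeze_zero (fun N => (width_pos F N).le) (width_le_pow F)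
    (tendsto_pow_atTop_nhds_zero_of_lt_one (by norm_num) (by norm_num))

theorem measurableSet_level [MeasurableSpace G] [DiscreteMeasurableSpace G] (N : ℕ) (I : G × ℝ) :
    MeasurableSet (level F N I) :=
  (MeasurableSet.of_discrete (s := {I.1})).prod measurableSet_Ico

end Width

section

variable {G : Type*} [AddCommGroup G] (F : ℕ → Operation G)

theorem exists_level_of_le {N N' : ℕ} (h : N ≤ N') {g : G} {I x : G × ℝ} (hI : I ∈ column F N g)
    (hx : x ∈ level F N I) : ∃ g', ∃ I' ∈ column F N' g', x ∈ level F N' I' := by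
  induction N', h using Nat.le_induction with
  | base => exact ⟨g, I, hI, hx⟩
  | succ N' _ ih =>
    obtain ⟨g', I', hI', hx'⟩ := ih
    obtain ⟨k, hk⟩ := exists_piece F N' I' x hx'
    exact ⟨g' - (F N').g k, _, (mem_column_succ F).2 ⟨k, Or.inl ⟨I', by rwa [sub_add_cancel], rfl⟩⟩,
      hk⟩

theorem level_subset_space {N : ℕ} {g : G} {I : G × ℝ} (hI : I ∈ column F N g) :
    level F N I ⊆ space F := fun _ hx =>
  Set.mem_iUnion.2 ⟨N, Set.mem_iUnion.2 ⟨g, Set.mem_iUnion₂.2 ⟨I, hI, hx⟩⟩⟩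

variable [MeasurableSpace G]

theorem measure_univ_eq_top [Infinite G] : measure F Set.univ = ⊤ := by
  have hsub : (Set.univ : Set G) ×ˢ Set.Ico (0 : ℝ) 1 ⊆ space F := by
    rintro ⟨a, t⟩ ⟨-, ht⟩
    refine level_subset_space F (N := 0) (g := a) (I := (a, 0)) (by simp [column]) ⟨rfl, ?_⟩
    simpa [width] using ht
  rw [measure, Measure.restrict_apply_univ, eq_top_iff]
  refine le_trans ?_ (measure_mono hsub)
  rw [Measure.prod_prod, Measure.count_apply_infinite Set.infinite_univ]
  simp

variable [DiscreteMeasurableSpace G] [Countable G]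

theorem measurableSet_space : MeasurableSet (space F) := by
  refine MeasurableSet.iUnion fun N => MeasurableSet.iUnion fun g => ?_
  exact MeasurableSet.biUnion (List.finite_toSet (column F N g)).countable
    fun I _ => measurableSet_level F N I

/-- A set of positive measure almost fills some level of every sufficiently late generation. -/
theorem eventually_exists_dense_level {A : Set (G × ℝ)} (hA : MeasurableSet A)
    (hpos : 0 < measure F A) {ε : ℝ} (hε : 0 < ε) :
    ∀ᶠ N in Filter.atTop, ∃ g, ∃ I ∈ column F N g,
      volume (Set.Ico I.2 (I.2 + width F N) \ Prod.mk I.1 ⁻¹' A) <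
        ENNReal.ofReal (ε * width F N) := by
  have hAs : MeasurableSet (A ∩ space F) := hA.inter (measurableSet_space F)
  rw [measure, Measure.restrict_apply hA] at hpos
  have hfib : ∃ a : G, volume (Prod.mk a ⁻¹' (A ∩ space F)) ≠ 0 := by
    by_contra! h
    refine hpos.ne' ((Measure.measure_prod_null hAs).2 (Filter.Eventually.of_forall h))
  obtain ⟨a, ha⟩ := hfib
  set S := Prod.mk a ⁻¹' (A ∩ space F)
  have hSm : MeasurableSet S := measurable_prodMk_left hAs
  -- The balls need only contain the density point, not be centred at it, so levels qualify.
  have hdens := (ae_restrict_iff' hSm).1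
    (IsUnifLocDoublingMeasure.ae_tendsto_measure_inter_div (volume : Measure ℝ) S 1)
  obtain ⟨t, htS, ht⟩ : ∃ t ∈ S, ∀ (w δ : ℕ → ℝ), Filter.Tendsto δ Filter.atTop
      (nhdsWithin 0 (Set.Ioi 0)) →
      (∀ᶠ j in Filter.atTop, t ∈ Metric.closedBall (w j) (1 * δ j)) →
      Filter.Tendsto (fun j => volume (S ∩ Metric.closedBall (w j) (δ j)) /
        volume (Metric.closedBall (w j) (δ j))) Filter.atTop (nhds 1) := by
    by_contra! h
    refine ha (measure_mono_null ?_ hdens)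
    intro t htS ht
    obtain ⟨w, δ, h1, h2, h3⟩ := h t htS
    exact h3 (ht htS w δ h1 h2)
  obtain ⟨N₀, hN₀⟩ := Set.mem_iUnion.1 htS.2
  obtain ⟨g₀, hg₀⟩ := Set.mem_iUnion.1 hN₀
  obtain ⟨I₀, hI₀, hx₀⟩ := Set.mem_iUnion₂.1 hg₀
  have hlev : ∀ N, ∃ (g : G) (I : G × ℝ), N₀ ≤ N → I ∈ column F N g ∧ (a, t) ∈ level F N I := by
    intro N
    by_cases h : N₀ ≤ N
    · obtain ⟨g, I, h1, h2⟩ := exists_level_of_le F h hI₀ hx₀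
      exact ⟨g, I, fun _ => ⟨h1, h2⟩⟩
    · exact ⟨0, 0, fun h' => (h h').elim⟩
  choose g I hI using hlev
  have hδ : Filter.Tendsto (fun N => width F N / 2) Filter.atTop (nhdsWithin 0 (Set.Ioi 0)) := by
    refine tendsto_nhdsWithin_iff.2 ⟨by simpa using (tendsto_width F).div_const 2, ?_⟩
    exact Filter.Eventually.of_forall fun N => half_pos (width_pos F N)
  have hball : ∀ N, Metric.closedBall ((I N).2 + width F N / 2) (width F N / 2) =
      Set.Icc (I N).2 ((I N).2 + width F N) := by
    intro N
    rw [Real.closedBall_eq_Icc]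
    congr 1 <;> ring
  have hlim := ht (fun N => (I N).2 + width F N / 2) (fun N => width F N / 2) hδ (by
    filter_upwards [Filter.eventually_ge_atTop N₀] with N hN
    rw [one_mul, hball]
    exact Set.Ico_subset_Icc_self (hI N hN).2.2)
  simp only [hball, Real.volume_Icc, add_sub_cancel_left] at hlim
  have hev := hlim.eventually (lt_mem_nhds (a := 1 - ENNReal.ofReal ε)
    (ENNReal.sub_lt_self ENNReal.one_ne_top one_ne_zero (by simpa using hε)))
  filter_upwards [hev, Filter.eventually_ge_atTop N₀] with N hN hN'
  obtain ⟨hIc, hIt⟩ := hI N hN'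
  have ha1 : a = (I N).1 := hIt.1
  refine ⟨g N, I N, hIc, ?_⟩
  have hw := width_pos F N
  have hw0 : ENNReal.ofReal (width F N) ≠ 0 := by simpa using hw
  rw [ENNReal.lt_div_iff_mul_lt (Or.inl hw0) (Or.inl ENNReal.ofReal_ne_top)] at hN
  have hsplit : volume (S ∩ Set.Icc (I N).2 ((I N).2 + width F N)) +
      volume (Set.Icc (I N).2 ((I N).2 + width F N) \ S) = ENNReal.ofReal (width F N) := by
    rw [Set.inter_comm, measure_inter_add_sdiff _ hSm, Real.volume_Icc, add_sub_cancel_left]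
  have hfin : volume (S ∩ Set.Icc (I N).2 ((I N).2 + width F N)) ≠ ⊤ :=
    ne_top_of_le_ne_top ENNReal.ofReal_ne_top (hsplit ▸ le_self_add)
  have hlt : volume (Set.Icc (I N).2 ((I N).2 + width F N) \ S) <
      ENNReal.ofReal (ε * width F N) := by
    rw [ENNReal.ofReal_mul hε.le]
    by_contra! hge
    have h1 : ENNReal.ofReal (width F N) ≤
        (1 - ENNReal.ofReal ε) * ENNReal.ofReal (width F N) +
          ENNReal.ofReal ε * ENNReal.ofReal (width F N) := by
      rw [← add_mul]
      exact le_mul_of_one_le_left' le_tsub_add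
    have hεw : ENNReal.ofReal ε * ENNReal.ofReal (width F N) ≠ ⊤ :=
      ENNReal.mul_ne_top ENNReal.ofReal_ne_top ENNReal.ofReal_ne_top
    have h2 := ENNReal.add_lt_add_of_lt_of_le hεw hN hge
    rw [hsplit] at h2
    exact absurd h1 h2.not_ge
  refine lt_of_le_of_lt (measure_mono ?_) hlt
  intro u hu
  refine ⟨Set.Ico_subset_Icc_self hu.1, fun huS => hu.2 ?_⟩
  rw [← ha1]
  exact huS.1

end

/-! ### Multiple recurrence -/

theorem Admissible.isRecurrent {G : Type*} [AddCommGroup G] [Countable G] [MeasurableSpace G]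
    [DiscreteMeasurableSpace G] {F : ℕ → Operation G} (hF : Admissible F) (d : ℕ) :
    IsRecurrent (measure F) (transformation F) d := by
  intro A hA hpos
  obtain ⟨M, hM⟩ := hF.exists_progression d
  -- With this `ε`, `d + 1` copies of the part of the level missed by `A` have total measure less
  -- than one sublevel.
  have hε : 0 < width F M / (d + 1) := div_pos (width_pos F M) (by positivity)
  obtain ⟨p, hp, g, I, hI, hdense⟩ :=
    ((Nat.frequently_atTop_iff_infinite.2 (hF 0 M)).and_eventually
      (eventually_exists_dense_level F hA hpos hε)).exists
  have hp' : ∀ i < M, F i = F (p + i) := fun i hi => by simpa using hp i hi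
  obtain ⟨n, hn, δ, z, h⟩ := hM p hp'
  choose! t ht using h
  obtain ⟨r, hr⟩ := List.mem_iff_getElem?.1 hI
  refine ⟨n, hn, ?_⟩
  set S : Set ℝ := Prod.mk I.1 ⁻¹' A
  set W := width F (p + M) with hW
  -- The highest sublevel of the progression: its points are reached by `T^(jn)` from sublevel `d -
  -- j`. `E` collects those whose translates in all the sublevels lie in `A`.
  set J : Set ℝ := Set.Ico (I.2 + t d) (I.2 + t d + W) with hJ
  set E : Set ℝ := {s ∈ J | ∀ j ≤ d, s + (t j - t d) ∈ S}
  have hcol : ∀ j ≤ d, (column F (p + M) (g - z))[r + (δ + j * n)]? = some (I.1, I.2 + t j) :=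
    fun j hj => (ht j hj).2.2 g r I hr
  have hEspace : {I.1} ×ˢ E ⊆ space F := fun x hx =>
    level_subset_space F (List.mem_iff_getElem?.2 ⟨_, hcol d le_rfl⟩) ⟨hx.1, hx.2.1⟩
  have hsub : {I.1} ×ˢ E ⊆ ⋂ j ∈ Finset.range (d + 1), (transformation F)^[j * n] '' A := by
    rintro ⟨b, s⟩ ⟨hb, hs, hsA⟩
    obtain rfl : b = I.1 := hb
    refine Set.mem_iInter₂.2 fun j hj => ?_
    have hj' : j ≤ d := by simpa [Nat.lt_succ_iff] using hj
    refine ⟨(I.1, s + (t (d - j) - t d)), hsA (d - j) (by omega), ?_⟩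
    have hidx : r + (δ + (d - j) * n) + j * n = r + (δ + d * n) := by
      rw [add_assoc, add_assoc, ← add_mul, Nat.sub_add_cancel hj']
    rw [iterate_transformation (hcol (d - j) (by omega)) (hidx ▸ hcol d le_rfl)]
    · simp only [Prod.mk.injEq, true_and]
      ring
    · obtain ⟨h1, h2⟩ := hs
      refine ⟨rfl, ?_, ?_⟩ <;> simp only <;> linarith
  refine lt_of_lt_of_le ?_ (measure_mono hsub)
  rw [measure, Measure.restrict_apply' (measurableSet_space F), Set.inter_eq_left.2 hEspace,
    Measure.prod_prod, Measure.count_singleton, one_mul, pos_iff_ne_zero]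
  intro hE0
  -- If `E` were null, `d + 1` translates of the missed part would cover almost all of `J`.
  have hcover : J ⊆ E ∪ ⋃ j ∈ Finset.range (d + 1),
      (fun s => s + (t j - t d)) ⁻¹' (Set.Ico I.2 (I.2 + width F p) \ S) := by
    intro s hs
    by_cases hsE : s ∈ E
    · exact Or.inl hsE
    · obtain ⟨j, hj, hjS⟩ : ∃ j ≤ d, s + (t j - t d) ∉ S := by
        by_contra! h
        exact hsE ⟨hs, h⟩
      refine Or.inr (Set.mem_iUnion₂.2 ⟨j, Finset.mem_range.2 (by omega), ⟨?_, ?_⟩, hjS⟩)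
      · linarith [hs.1, (ht j hj).1]
      · linarith [hs.2, (ht j hj).2.1]
  have hle : volume J ≤ (d + 1 : ℕ) • volume (Set.Ico I.2 (I.2 + width F p) \ S) := by
    refine (measure_mono hcover).trans ((measure_union_le _ _).trans ?_)
    rw [hE0, zero_add]
    refine (measure_biUnion_finset_le _ _).trans ?_
    simp only [measure_preimage_add_right, Finset.sum_const, Finset.card_range, le_refl]
  have hlt : (d + 1 : ℕ) • volume (Set.Ico I.2 (I.2 + width F p) \ S) < ENNReal.ofReal W := by
    have hd : ((d + 1 : ℕ) : ENNReal) ≠ 0 := by exact_mod_cast Nat.succ_ne_zero d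
    have hWeq : ENNReal.ofReal W = ((d + 1 : ℕ) : ENNReal) *
        ENNReal.ofReal (width F M / (d + 1) * width F p) := by
      rw [← ENNReal.ofReal_natCast, ← ENNReal.ofReal_mul (Nat.cast_nonneg _), hW,
        width_add F p M hp']
      congr 1
      push_cast
      field_simp
    rw [nsmul_eq_mul, hWeq]
    exact (ENNReal.mul_lt_mul_iff_right hd (ENNReal.natCast_ne_top _)).2 hdense
  rw [hJ, Real.volume_Ico, add_sub_cancel_left] at hle
  exact absurd hle hlt.not_ge

end CutStack

/-- For every countable discrete abelian group `G` and every admissible sequence of operations, the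
resulting transformation is multiply recurrent; if `G` is infinite, the measure is infinite. -/
theorem mainTheorem2 {G : Type*} [AddCommGroup G] [Countable G] [MeasurableSpace G]
    [DiscreteMeasurableSpace G] (F : ℕ → CutStack.Operation G) (hF : CutStack.Admissible F) :
    CutStack.MultiplyRecurrent (CutStack.measure F) (CutStack.transformation F) ∧
      (Infinite G → CutStack.measure F Set.univ = ⊤) :=
  ⟨fun d _ => hF.isRecurrent d, fun _ => CutStack.measure_univ_eq_top F⟩
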